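/- **Setting.** Let $\mathbb F$ be a finite field, $n\ge 1$ and $\mathcal I=\{0,\dots,n-1\}$, with indices read modulo $n$. For $a,b\in\mathcal I$ let $[a,b]=\{a,\dots,b\}$ if $a\le b$ and $[a,b]=\{a,\dots,n-1,0,\dots,b\}$ if $a>b$, and let $(a,b]=[a,b]\setminus\{a\}$. The interval $(a,b]$ is a *span* of $c\in\mathbb F^n$ if $c_a\ne0\neq c_b$ and $c_j=0$ for $j\notin[a,b]$. (A span is given together with its endpoints $a,b$.) A code $\mathcal C\subseteq\mathbb F^n$ is a linear subspace; it has *full support* if for every $i\in\mathcal I$ some $c\in\mathcal C$ has $c_i\neq0$. The dual code $\mathcal C^\perp$ is taken with respect to the standard bilinear form on $\mathbb F^n$. A *characteristic pair* of a $k$-dimensional code $\mathcal C\subseteq\mathbb F^n$ is a pair $(X,\mathcal T)$ of a matrix $X\in\mathbb F^{n\times n}$ with rows $x_1,\dots,x_n$ and a list $\mathcal T=[(a_l,b_l],\ l=1,\dots,n]$ such that the rows of $X$ span $\mathcal C$; $(a_l,b_l]$ is a span of $x_l$ for each $l$; $a_1,\dots,a_n$ are distinct and $b_1,\dots,b_n$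 are distinct; and each $j\in\mathcal I$ lies in exactly $n-k$ of the intervals $(a_l,b_l]$. Then $X$ is called a *characteristic matrix* of $\mathcal C$. A *(tail-biting) trellis* $T$ of depth $n$ is given by vertex sets $V_i$ and edge sets $E_i\subseteq V_i\times\mathbb F\times V_{i+1}$, $i\in\mathcal I$ (with $V_n=V_0$). A *cycle* is a sequence $(v_0,c_0,\dots,v_{n-1},c_{n-1})$ with $(v_i,c_i,v_{i+1})\in E_i$ for all $i\in\mathcal I$, where $v_n=v_0$. The trellis is *linear* if the $V_i$ are $\mathbb F$-vector spaces, every vertex and every edge lies on a cycle, and the set of all cycles is a linear subspace of $V_0\times\mathbb F\times\dots\times V_{n-1}\times\mathbb F$. It *represents* $\mathcal C$ if $\mathcal C$ is the set of the label sequences $(c_0,\dots,c_{n-1})$ of its cycles. A linear trellis representing $\mathcal C$ is *minimal* if no linear trellis representing $\mathcal C$, with vertex spaces $V_i'$, satisfies $|V'_i|\le|V_i|$ for all $i$ and $|V_j'|<|V_j|$ for some $j$. For a span $(a,b]$ of $c$, with indicator function $I=I^{(a,b]}\in\mathbb F^n$, the *elementary trellis* $T_{c,(a,b]}$ has $V_i=\{\alpha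 I_i\mid\alpha\in\mathbb F\}$ and $E_i=\{(\alpha I_i,\alpha c_i,\alpha I_{i+1})\mid\alpha\in\mathbb F\}$. The product of trellises has as vertices the tuples of vertices and as edges the tuples of edges of the factors, the labels being added. If $k$ rows $x_{l_1},\dots,x_{l_k}$ of a characteristic matrix of the $k$-dimensional code $\mathcal C$ are linearly independent, then the product trellis $T_{x_{l_1},(a_{l_1},b_{l_1}]}\times\dots\times T_{x_{l_k},(a_{l_k},b_{l_k}]}$ is called a *KV-trellis* of $\mathcal C$. **Theorem.** Let $\mathcal C\subseteq\mathbb F^n$ be a $k$-dimensional code such that $\mathcal C$ and $\mathcal C^\perp$ both have full support, and let $(X,\mathcal T)$ be a characteristic pair of $\mathcal C$, where $\mathcal T=[(a_l,b_l],\ l=1,\dots,n]$. Suppose that the rows of $X$ with indices $l_1,\dots,l_k$ are linearly independent and that the resulting KV-trellis is a minimal trellis of $\mathcal C$. Then there is a characteristic pair $(\hat X,\hat{\mathcal T})$ of $\mathcal C^\perp$ such that exactly $n-k$ rows of $\hat X$ have a span in $\hat{\mathcal T}$ that is none of $(b_{l_1},a_{l_1}],\dots,(b_{l_k},a_{l_k}]$,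 these $n-k$ rows are linearly independent, and the resulting KV-trellis is a minimal trellis of $\mathcal C^\perp$. -/

import Mathlib

universe u

namespace TailBiting

/-! ### Codes of length `n`: the coordinates are indexed by `Fin n = {0, …, n - 1}` -/

/-- The code `C` has full support: no coordinate vanishes identically on `C`. -/
def FullSupport {F : Type u} [Field F] {n : ℕ} (C : Submodule F (Fin n → F)) : Prop :=
  ∀ i, ∃ c ∈ C, c i ≠ 0

/-- The dual code, with respect to the standard bilinear form on `F ^ n`. -/
def dualCode {F : Type u} [Field F] {n : ℕ} (C : Submodule F (Fin n → F)) :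
    Submodule F (Fin n → F) where
  carrier := {y | ∀ x ∈ C, ∑ i, x i * y i = 0}
  zero_mem' := by simp
  add_mem' := by
    intro y z hy hz x hx
    simp [mul_add, Finset.sum_add_distrib, hy x hx, hz x hx]
  smul_mem' := by
    intro r y hy x hx
    have h : ∑ i, x i * (r • y) i = r * ∑ i, x i * y i := by
      rw [Finset.mul_sum]
      exact Finset.sum_congr rfl fun i _ => by simp [mul_left_comm]
    rw [h, hy x hx, mul_zero]

/-! ### Cyclic intervals and spans -/

/-- The closed interval `[a, b]` of the cyclic time axis: `{a, …, b}` if `a ≤ b`, and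
`{a, …, n - 1, 0, …, b}` if `a > b`. -/
def closedInterval {n : ℕ} (a b : Fin n) : Set (Fin n) :=
  if a ≤ b then {j | a ≤ j ∧ j ≤ b} else {j | a ≤ j ∨ j ≤ b}

/-- The half-open interval `(a, b] = [a, b] \ {a}` of the cyclic time axis. -/
def halfOpenInterval {n : ℕ} (a b : Fin n) : Set (Fin n) :=
  closedInterval a b \ {a}

/-- `s = (a, b)` describes a span `(a, b]` of the vector `c`:
`c` is nonzero at `a` and at `b`, and vanishes outside `[a, b]`. -/
def IsSpan {F : Type u} [Field F] {n : ℕ} (c : Fin n → F) (s : Fin n × Fin n) : Prop :=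
  c s.1 ≠ 0 ∧ c s.2 ≠ 0 ∧ ∀ j, j ∉ closedInterval s.1 s.2 → c j = 0

/-- The indicator function of `(a, b]`, with values in `F`; here `s = (a, b)`. -/
noncomputable def spanIndicator (F : Type u) [Field F] {n : ℕ} (s : Fin n × Fin n) : Fin n → F :=
  Set.indicator (halfOpenInterval s.1 s.2) 1

/-- `(X, T)` is a characteristic pair of the code `C`; the rows of `X` are `X l`, and the pair
`T l = (a_l, b_l)` stands for the span `(a_l, b_l]`. -/
structure IsCharacteristicPair {F : Type u} [Field F] {n : ℕ} (C : Submodule F (Fin n → F))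
    (X : Matrix (Fin n) (Fin n) F) (T : Fin n → Fin n × Fin n) : Prop where
  span_rows : Submodule.span F (Set.range X.row) = C
  isSpan : ∀ l, IsSpan (X.row l) (T l)
  start_injective : Function.Injective fun l => (T l).1
  end_injective : Function.Injective fun l => (T l).2
  ncard_eq : ∀ j, {l | j ∈ halfOpenInterval (T l).1 (T l).2}.ncard = n - Module.finrank F C

/-! ### Tail-biting trellises -/

/-- A tail-biting trellis of depth `n` over `F` whose vertex sets are vector spaces.
The edges leaving `V i` are the triples `(v, a, w)` (starting vertex, label, end vertex) in `E i`;
the index `i + 1` is computed modulo `n`. Linearity of the trellis is `Trellis.IsLinear` below. -/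
structure Trellis (F : Type u) [Field F] (n : ℕ) [NeZero n] where
  V : Fin n → Type u
  [addCommGroup : ∀ i, AddCommGroup (V i)]
  [module : ∀ i, Module F (V i)]
  E : ∀ i, Set (V i × F × V (i + 1))

namespace Trellis

variable {F : Type u} [Field F] {n : ℕ} [NeZero n]

attribute [instance] Trellis.addCommGroup Trellis.module

/-- The label code: the vertex and edge-label sequences of all cycles (of length `n`). -/
def labelCode (T : Trellis F n) : Set ((∀ i, T.V i) × (Fin n → F)) :=
  {p | ∀ i, (p.1 i, p.2 i, p.1 (i + 1)) ∈ T.E i}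

/-- The edge-label code: the edge-label sequences of all cycles. -/
def edgeLabelCode (T : Trellis F n) : Set (Fin n → F) :=
  {c | ∃ v : ∀ i, T.V i, (v, c) ∈ T.labelCode}

/-- Every vertex and every edge lies on a cycle. -/
def IsReduced (T : Trellis F n) : Prop :=
  (∀ i, ∀ v : T.V i, ∃ p ∈ T.labelCode, p.1 i = v) ∧
    ∀ i, ∀ e ∈ T.E i, ∃ p ∈ T.labelCode, (p.1 i, p.2 i, p.1 (i + 1)) = e

/-- The trellis is reduced and its label code is a linear subspace. -/
def IsLinear (T : Trellis F n) : Prop :=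
  T.IsReduced ∧ ∃ S : Submodule F ((∀ i, T.V i) × (Fin n → F)), (S : Set _) = T.labelCode

/-- The trellis represents the code `C`. -/
def Represents (T : Trellis F n) (C : Submodule F (Fin n → F)) : Prop :=
  T.edgeLabelCode = C

/-- `T` is a minimal (linear) trellis of `C`: no linear trellis of `C` has vertex sets that are
all at most as large as those of `T`, one of them being smaller. -/
def IsMinimal (T : Trellis F n) (C : Submodule F (Fin n → F)) : Prop :=
  T.IsLinear ∧ T.Represents C ∧
    ¬ ∃ T' : Trellis F n, T'.IsLinear ∧ T'.Represents C ∧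
      (∀ i, Cardinal.mk (T'.V i) ≤ Cardinal.mk (T.V i)) ∧
      ∃ j, Cardinal.mk (T'.V j) < Cardinal.mk (T.V j)

/-- The elementary trellis of the pair `(c, (a, b])`, where `s = (a, b)`. With `I` the indicator
function of `(a, b]`, its vertex spaces are `im (I_i)` (that is, `F` if `i ∈ (a, b]`, and `0`
otherwise) and its edge spaces are `im (I_i, c_i, I_{i+1})`. -/
noncomputable def elementary (c : Fin n → F) (s : Fin n × Fin n) : Trellis F n where
  V i := Submodule.span F {spanIndicator F s i}
  E i := Set.range fun α : F =>
    (⟨α * spanIndicator F s i, Submodule.mem_span_singleton.2 ⟨α, rfl⟩⟩, α * c i,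
      ⟨α * spanIndicator F s (i + 1), Submodule.mem_span_singleton.2 ⟨α, rfl⟩⟩)

/-- The product of a finite family of trellises: vertices are tuples of vertices, edges are
tuples of edges, the labels being added. -/
def product {ι : Type} [Fintype ι] (T : ι → Trellis F n) : Trellis F n where
  V i := ∀ l, (T l).V i
  E i := {e | ∃ a : ι → F, (∀ l, (e.1 l, a l, e.2.2 l) ∈ (T l).E i) ∧ e.2.1 = ∑ l, a l}

end Trellis

/-- The product of the elementary trellises of the rows of `X` with index in `L`, with respect
to the spans listed in `T`. -/
noncomputable def selectionTrellis {F : Type u} [Field F] {n : ℕ} [NeZero n]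
    (X : Matrix (Fin n) (Fin n) F) (T : Fin n → Fin n × Fin n) (L : Finset (Fin n)) :
    Trellis F n :=
  Trellis.product fun l : {l // l ∈ L} => Trellis.elementary (X.row l) (T l)

/-- The indices `j` of the rows of a characteristic pair with span list `T'` whose span is not one
of the reversed spans `(b_l, a_l]`, `l ∈ L`, where `T l = (a_l, b_l)`. -/
def complementaryRows {n : ℕ} (T : Fin n → Fin n × Fin n) (L : Finset (Fin n))
    (T' : Fin n → Fin n × Fin n) : Finset (Fin n) :=
  {j | ∀ l ∈ L, T' j ≠ ((T l).2, (T l).1)}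

end TailBiting

/-! Reversing all spans turns `(X, T)` into a characteristic pair of the dual code for a suitable
matrix `X'`, and choosing the complementary rows of `X'` gives vertex spaces of the same dimensions
as before.

`exists_dual` constructs `X'`. Cutting a linear dependency of the rows of `X` at time `0` leaves a
vector modulo `C`, and this identifies the space of dependencies with `F ^ n / C`. Let `e j` be the
dependency belonging to the `j`-th unit vector, and let the `e j` be the columns of `X'`. A vector
`c` of the code is zero in the quotient, so `∑ c_j e_j = 0`: the rows of `X'` lie in the dual code.
Moving the cut does not change the class, so `e j m` is a coordinate of the unit vector with respect
to the rows cut at any time `i` in the span of row `m` (`dependency_apply`); suitable choices of `i`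
show that row `m` of `X'` has span `(b_m, a_m]`. The columns of `X'` span the left kernel of `X`, so
the two row matroids are dual, and the complement of a basis is independent.

Minimality passes over by trellis duality (`represents_localDual`): a smaller linear trellis of the
dual code, dualized and trimmed, would be a linear trellis of `C` smaller than the given one. -/

namespace TailBiting

/-! ### Cyclic intervals in terms of the cyclic distance -/

section Cyclic

variable {n : ℕ}

lemma val_sub_eq_ite (a b : Fin n) :
    (a - b).val = if b ≤ a then a.val - b.val else n + a.val - b.val := by
  have ha := a.isLt
  have hb := b.isLt
  split_ifs with h
  · exact Fin.sub_val_of_le h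
  · rw [Fin.le_def] at h
    rw [Fin.sub_def]
    show (n - b.val + a.val) % n = _
    rw [Nat.mod_eq_of_lt (by omega)]
    omega

lemma mem_closedInterval_iff {a b j : Fin n} :
    j ∈ closedInterval a b ↔ (j - a).val ≤ (b - a).val := by
  have ha := a.isLt
  have hb := b.isLt
  have hj := j.isLt
  unfold closedInterval
  simp only [val_sub_eq_ite, Fin.le_def]
  split_ifs <;> simp only [Set.mem_ofPred_eq] <;> omega

lemma mem_halfOpenInterval_iff {a b j : Fin n} :
    j ∈ halfOpenInterval a b ↔ (j - a).val ≤ (b - a).val ∧ j ≠ a := by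
  simp [halfOpenInterval, mem_closedInterval_iff]

/-- The reason that reversed spans belong to the dual: they are the complements of the original
ones. For `a = b` both intervals would be empty. -/
lemma mem_halfOpenInterval_swap {a b : Fin n} (h : a ≠ b) (j : Fin n) :
    j ∈ halfOpenInterval b a ↔ j ∉ halfOpenInterval a b := by
  have ha := a.isLt
  have hb := b.isLt
  have hj := j.isLt
  rw [mem_halfOpenInterval_iff, mem_halfOpenInterval_iff]
  simp only [val_sub_eq_ite, Fin.le_def, Ne, Fin.ext_iff] at *
  split_ifs <;> omega

lemma end_mem_halfOpenInterval {a b : Fin n} (h : a ≠ b) : b ∈ halfOpenInterval a b :=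
  mem_halfOpenInterval_iff.2 ⟨le_rfl, h.symm⟩

lemma val_add_one_eq_ite [NeZero n] (i : Fin n) :
    (i + 1).val = if i.val + 1 = n then 0 else i.val + 1 := by
  have hi := i.isLt
  rw [Fin.val_add, Fin.val_one']
  split_ifs with h
  · rcases Nat.lt_or_ge 1 n with h1 | h1
    · rw [Nat.mod_eq_of_lt h1, h, Nat.mod_self]
    · have : n = 1 := by omega
      subst this
      omega
  · rw [Nat.mod_eq_of_lt (a := 1) (by omega), Nat.mod_eq_of_lt (by omega)]

/-- The successor of a point of `[a, b]` other than `b` lies in `(a, b]`. -/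
lemma succ_mem_halfOpenInterval [NeZero n] {a b i : Fin n} (h : i ∈ closedInterval a b)
    (hb : i ≠ b) : i + 1 ∈ halfOpenInterval a b := by
  have ha := a.isLt
  have hb' := b.isLt
  have hj := i.isLt
  rw [mem_halfOpenInterval_iff]
  rw [mem_closedInterval_iff] at h
  simp only [val_sub_eq_ite, Fin.le_def, Ne, Fin.ext_iff, val_add_one_eq_ite] at *
  split_ifs at * <;> omega

/-- Predecessors of points of `(a, b]` lie in `[a, b]`. -/
lemma mem_closedInterval_of_succ [NeZero n] {a b i : Fin n} (h : i + 1 ∈ halfOpenInterval a b) :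
    i ∈ closedInterval a b := by
  have ha := a.isLt
  have hb' := b.isLt
  have hj := i.isLt
  rw [mem_halfOpenInterval_iff] at h
  rw [mem_closedInterval_iff]
  simp only [val_sub_eq_ite, Fin.le_def, Ne, Fin.ext_iff, val_add_one_eq_ite] at *
  split_ifs at * <;> omega

end Cyclic

/-! ### Dual codes -/

section DualCode

variable {F : Type u} [Field F] {n : ℕ}

lemma dualCode_eq_orthogonal (C : Submodule F (Fin n → F)) :
    dualCode C = LinearMap.BilinForm.orthogonal (dotProductBilin F F) C := by
  ext y
  rfl

lemma dotProductBilin_isRefl :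
    LinearMap.BilinForm.IsRefl (dotProductBilin F F : LinearMap.BilinForm F (Fin n → F)) := by
  intro x y h
  change x ⬝ᵥ y = 0 at h
  change y ⬝ᵥ x = 0
  rwa [dotProduct_comm]

lemma dotProductBilin_nondegenerate :
    LinearMap.BilinForm.Nondegenerate
      (dotProductBilin F F : LinearMap.BilinForm F (Fin n → F)) := by
  refine ⟨fun x h => dotProduct_eq_zero x fun y => h y, fun x h => dotProduct_eq_zero x fun y => ?_⟩
  rw [dotProduct_comm]
  exact h y

lemma dualCode_dualCode (C : Submodule F (Fin n → F)) : dualCode (dualCode C) = C := by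
  rw [dualCode_eq_orthogonal, dualCode_eq_orthogonal]
  exact LinearMap.BilinForm.orthogonal_orthogonal dotProductBilin_nondegenerate
    dotProductBilin_isRefl C

lemma finrank_dualCode (C : Submodule F (Fin n → F)) :
    Module.finrank F (dualCode C) = n - Module.finrank F C := by
  rw [dualCode_eq_orthogonal,
    LinearMap.BilinForm.finrank_orthogonal dotProductBilin_nondegenerate, Module.finrank_fin_fun]

lemma finrank_code_le (C : Submodule F (Fin n → F)) : Module.finrank F C ≤ n := by
  simpa using C.finrank_le

end DualCode

/-- A finite family of vectors with pairwise distinct starting positions is linearly independent. -/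
lemma linearIndependent_of_start {F ι κ : Type*} [Field F] [Fintype ι]
    (y : ι → κ → F) (s : ι → κ) (d : κ → ℕ) (hd : Function.Injective fun l => d (s l))
    (h1 : ∀ l, y l (s l) ≠ 0) (h2 : ∀ l t, d t < d (s l) → y l t = 0) :
    LinearIndependent F y := by
  rw [Fintype.linearIndependent_iff]
  intro g hg
  by_contra! hne
  classical
  -- Among the vectors with nonzero coefficient, the one starting earliest is the only one
  -- contributing at its starting position.
  obtain ⟨l, hl, hmin⟩ := Finset.exists_min_image (Finset.univ.filter fun l => g l ≠ 0)
    (fun l => d (s l)) (by simpa [Finset.filter_nonempty_iff] using hne)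
  have := congrFun hg (s l)
  rw [Finset.sum_apply, Finset.sum_eq_single l] at this
  · rcases mul_eq_zero.1 this with h | h
    · exact (Finset.mem_filter.1 hl).2 h
    · exact h1 l h
  · intro m _ hm
    by_cases hgm : g m = 0
    · simp [hgm]
    · have hle := hmin m (Finset.mem_filter.2 ⟨Finset.mem_univ _, hgm⟩)
      have hlt : d (s l) < d (s m) := lt_of_le_of_ne hle fun h => hm (hd h).symm
      simp [h2 m _ hlt]
  · simp

end TailBiting

/-! ### Characteristic matrices of the dual code. -/

namespace TailBiting

section Core

variable {F : Type u} [Field F] {n : ℕ}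

/-- The row `x_l` truncated to the cyclic interval `{a_l, …, i - 1}`. -/
def pastRow (X : Matrix (Fin n) (Fin n) F) (T : Fin n → Fin n × Fin n) (i l : Fin n) :
    Fin n → F :=
  fun t => if (t - (T l).1).val < (i - (T l).1).val then X l t else 0

open Classical in
/-- The row `x_l`, truncated to its past at time `i` if its span contains `i`. -/
noncomputable def cutRow (X : Matrix (Fin n) (Fin n) F) (T : Fin n → Fin n × Fin n)
    (i l : Fin n) : Fin n → F :=
  if i ∈ halfOpenInterval (T l).1 (T l).2 then pastRow X T i l else X l

variable {C : Submodule F (Fin n → F)} {X : Matrix (Fin n) (Fin n) F}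
  {T : Fin n → Fin n × Fin n}

lemma IsSpan.eq_zero_of_lt {c : Fin n → F} {s : Fin n × Fin n} (h : IsSpan c s) {j : Fin n}
    (hj : (s.2 - s.1).val < (j - s.1).val) : c j = 0 :=
  h.2.2 j fun h' => by rw [mem_closedInterval_iff] at h'; omega

namespace IsCharacteristicPair

lemma row_mem (hX : IsCharacteristicPair C X T) (l : Fin n) : X l ∈ C := by
  rw [← hX.span_rows]
  exact Submodule.subset_span ⟨l, rfl⟩

/-- Otherwise the row would be a nonzero multiple of a unit vector, and the dual code would vanish
at that coordinate. -/
lemma start_ne_end (hX : IsCharacteristicPair C X T) (hC' : FullSupport (dualCode C))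
    (l : Fin n) : (T l).1 ≠ (T l).2 := by
  intro h
  obtain ⟨c, hc, hc0⟩ := hC' (T l).1
  have hs := hX.isSpan l
  have h0 := hc (X l) (hX.row_mem l)
  rw [Finset.sum_eq_single (T l).1] at h0
  · exact (mul_ne_zero hs.1 hc0) h0
  · intro j _ hj
    have : X l j = 0 := by
      refine hs.2.2 j fun hj' => hj ?_
      rw [mem_closedInterval_iff, ← h, val_sub_eq_ite (T l).1] at hj'
      have := j.isLt
      have := (T l).1.isLt
      simp only [val_sub_eq_ite, Fin.le_def, Fin.ext_iff] at *
      split_ifs at * <;> omega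
    rw [this, zero_mul]
  · simp

lemma cutRow_start (hX : IsCharacteristicPair C X T) (i l : Fin n) :
    cutRow X T i l (T l).1 ≠ 0 := by
  have hs := (hX.isSpan l).1
  unfold cutRow
  split_ifs with h
  · have hlt : ((T l).1 - (T l).1).val < (i - (T l).1).val := by
      have h2 := (mem_halfOpenInterval_iff.1 h).2
      have := i.isLt
      have := (T l).1.isLt
      simp only [val_sub_eq_ite, Fin.le_def, Ne, Fin.ext_iff] at *
      split_ifs <;> omega
    rw [pastRow, if_pos hlt]
    exact hs
  · exact hs

lemma cutRow_eq_zero (hX : IsCharacteristicPair C X T) (i l t : Fin n)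
    (ht : (t - i).val < ((T l).1 - i).val) : cutRow X T i l t = 0 := by
  have := i.isLt
  have := (T l).1.isLt
  have := (T l).2.isLt
  have := t.isLt
  unfold cutRow
  split_ifs with h
  · rw [pastRow, if_neg]
    simp only [val_sub_eq_ite, Fin.le_def] at *
    split_ifs at * <;> omega
  · apply (hX.isSpan l).eq_zero_of_lt
    rw [mem_halfOpenInterval_iff] at h
    simp only [val_sub_eq_ite, Fin.le_def, Ne, Fin.ext_iff] at *
    split_ifs at * <;> omega

/-- When the cyclic axis is read from `i` onwards, no cut row wraps around, so each begins at its
own `a_l`, and these are distinct. -/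
lemma linearIndependent_cutRow (hX : IsCharacteristicPair C X T) (i : Fin n) :
    LinearIndependent F (cutRow X T i) := by
  refine linearIndependent_of_start _ (fun l => (T l).1) (fun t => (t - i).val) ?_
    (hX.cutRow_start i) (hX.cutRow_eq_zero i)
  intro l m h
  apply hX.start_injective
  have := i.isLt
  have := (T l).1.isLt
  have := (T m).1.isLt
  simp only [val_sub_eq_ite, Fin.le_def, Fin.ext_iff] at *
  split_ifs at * <;> omega

/-- The rows cut at time `i`, as a basis of `F ^ n`. -/
noncomputable def cutBasis [NeZero n] (hX : IsCharacteristicPair C X T) (i : Fin n) :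
    Module.Basis (Fin n) F (Fin n → F) :=
  basisOfLinearIndependentOfCardEqFinrank (hX.linearIndependent_cutRow i) (by simp)

lemma cutBasis_apply [NeZero n] (hX : IsCharacteristicPair C X T) (i l : Fin n) :
    hX.cutBasis i l = cutRow X T i l := by
  simp [cutBasis]

/-- The rows whose span does not contain `i` form a basis of the code, so that the elements of the
code have no coordinates at the rows whose span contains `i`. -/
lemma cutBasis_repr_eq_zero [NeZero n] (hX : IsCharacteristicPair C X T) {i l : Fin n}
    (hl : i ∈ halfOpenInterval (T l).1 (T l).2) {c : Fin n → F} (hc : c ∈ C) :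
    (hX.cutBasis i).repr c l = 0 := by
  classical
  set S : Set (Fin n) := {l | i ∉ halfOpenInterval (T l).1 (T l).2} with hS
  have hrow : ∀ m : S, hX.cutBasis i m = X m := fun m => by
    rw [cutBasis_apply, cutRow, if_neg m.2]
  have hli : LinearIndependent F fun m : S => hX.cutBasis i m :=
    (hX.cutBasis i).linearIndependent.comp _ Subtype.val_injective
  -- Exactly `n - k` spans contain `i`, so `k` rows remain uncut; being independent elements of the
  -- code, they span it.
  have hSC : Submodule.span F (Set.range fun m : S => hX.cutBasis i m) = C := by
    apply Submodule.eq_of_le_of_finrank_eq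
    · rw [Submodule.span_le]
      rintro _ ⟨m, rfl⟩
      simp only [hrow]
      exact hX.row_mem _
    · rw [finrank_span_eq_card hli, ← Nat.card_eq_fintype_card, Nat.card_coe_set_eq]
      have h1 := Set.ncard_add_ncard_compl {l | i ∈ halfOpenInterval (T l).1 (T l).2}
      rw [hX.ncard_eq i, Nat.card_fin] at h1
      have h2 : S = {l | i ∈ halfOpenInterval (T l).1 (T l).2}ᶜ := rfl
      rw [h2]
      have := finrank_code_le C
      omega
  rw [← hSC] at hc
  induction hc using Submodule.span_induction with
  | mem x hx =>
    obtain ⟨m, rfl⟩ := hx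
    have : (m : Fin n) ≠ l := fun h => m.2 (h ▸ hl)
    simp [this]
  | zero => simp
  | add x y _ _ hx hy => simp [hx, hy]
  | smul r x _ hx => simp [hx]

/-- Cut right after its start, row `s` retains only its first entry, so it is a multiple of a unit
vector. -/
lemma cutBasis_repr_single [NeZero n] (hX : IsCharacteristicPair C X T) {s : Fin n}
    (hne : (T s).1 ≠ (T s).2) :
    (hX.cutBasis ((T s).1 + 1)).repr (Pi.single (T s).1 1) =
      Finsupp.single s (X s (T s).1)⁻¹ := by
  have h0 : X s (T s).1 ≠ 0 := (hX.isSpan s).1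
  have hmem : (T s).1 + 1 ∈ halfOpenInterval (T s).1 (T s).2 :=
    succ_mem_halfOpenInterval (mem_closedInterval_iff.2 (by simp)) hne
  have h : Pi.single (T s).1 1 = (X s (T s).1)⁻¹ • hX.cutBasis ((T s).1 + 1) s := by
    ext t
    rw [cutBasis_apply, cutRow, if_pos hmem]
    simp only [Pi.smul_apply, smul_eq_mul, pastRow]
    have := t.isLt
    have := (T s).1.isLt
    have := (T s).2.isLt
    rcases eq_or_ne t (T s).1 with rfl | ht
    · rw [if_pos, Pi.single_eq_same, inv_mul_cancel₀ h0]
      simp only [val_sub_eq_ite, val_add_one_eq_ite, Fin.le_def, Ne, Fin.ext_iff] at *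
      split_ifs at * <;> omega
    · rw [if_neg, Pi.single_eq_of_ne ht, mul_zero]
      simp only [val_sub_eq_ite, val_add_one_eq_ite, Fin.le_def, Ne, Fin.ext_iff] at *
      split_ifs at * <;> omega
  rw [h, map_smul, Module.Basis.repr_self, Finsupp.smul_single, smul_eq_mul, mul_one]

/-- Up to elements of the code, the past of a row at time `i` differs from its past at time `0`
by its restriction to `{0, …, i - 1}`. -/
lemma pastRow_sub_mem [NeZero n] (hX : IsCharacteristicPair C X T) (i l : Fin n) :
    pastRow X T i l - pastRow X T 0 l - (fun t => if t < i then X l t else 0) ∈ C := by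
  have hz : (0 : Fin n).val = 0 := rfl
  have := i.isLt
  have := (T l).1.isLt
  by_cases h : (T l).1 = 0 ∨ i < (T l).1
  · convert C.zero_mem using 1
    ext t
    have := t.isLt
    simp only [pastRow, val_sub_eq_ite, Fin.le_def, Fin.ext_iff, Fin.lt_def, hz, Pi.sub_apply,
      Pi.zero_apply] at *
    split_ifs <;> first | omega | simp
  -- Here `0 < a_l ≤ i`: the two pasts are `{a_l, …, i - 1}` and `{a_l, …, n - 1}`, and the
  -- combination is exactly `-x_l`.
  · convert C.neg_mem (hX.row_mem l) using 1
    ext t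
    have := t.isLt
    simp only [pastRow, val_sub_eq_ite, Fin.le_def, Fin.ext_iff, Fin.lt_def, hz, Pi.sub_apply,
      Pi.neg_apply] at *
    split_ifs <;> first | omega | simp

/-- Outside the span the past is either empty (`i = a_l`) or the whole row. -/
lemma pastRow_mem (hX : IsCharacteristicPair C X T) {i l : Fin n}
    (h : i ∉ halfOpenInterval (T l).1 (T l).2) : pastRow X T i l ∈ C := by
  rw [mem_halfOpenInterval_iff] at h
  by_cases hi : i = (T l).1
  · convert C.zero_mem using 1
    ext t
    have := t.isLt
    have := (T l).1.isLt
    subst hi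
    simp only [pastRow, val_sub_eq_ite, Fin.le_def, Pi.zero_apply]
    split_ifs <;> first | omega | rfl
  · convert hX.row_mem l using 1
    ext t
    rw [pastRow]
    split_ifs with h'
    · rfl
    · refine ((hX.isSpan l).eq_zero_of_lt ?_).symm
      simp only [hi, ne_eq, not_false_eq_true, and_true, not_le] at h
      omega

/-- The coefficients of a linear dependency of the rows are determined by its past at time `0`. -/
lemma dependency_apply [NeZero n] (hX : IsCharacteristicPair C X T) {c w : Fin n → F}
    (hc : Matrix.vecMul c X = 0) (hw : ∑ l, c l • pastRow X T 0 l - w ∈ C) {i l : Fin n}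
    (hl : i ∈ halfOpenInterval (T l).1 (T l).2) : c l = (hX.cutBasis i).repr w l := by
  -- A dependency holds coordinatewise, so it survives restriction to `{0, …, i - 1}`; hence its
  -- pasts at `i` and at `0` agree modulo the code.
  have h1 : ∑ l, c l • (fun t => if t < i then X l t else 0 : Fin n → F) = 0 := by
    ext t
    have := congrFun hc t
    simp only [Matrix.vecMul, dotProduct, Pi.zero_apply] at this
    by_cases ht : t < i <;> simp [ht, this]
  have h2 : ∑ l, c l • pastRow X T i l - w ∈ C := by
    have := C.add_mem hw (C.sum_mem (t := Finset.univ) fun l _ =>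
      C.smul_mem (c l) (hX.pastRow_sub_mem i l))
    simp only [smul_sub, Finset.sum_sub_distrib, h1] at this
    convert this using 1
    abel
  -- Passing from pasts to cut rows only alters rows not active at `i`, by elements of the code.
  have h3 : ∑ l, c l • hX.cutBasis i l - w ∈ C := by
    have : ∑ l, c l • (hX.cutBasis i l - pastRow X T i l) ∈ C := by
      refine C.sum_mem fun l _ => C.smul_mem _ ?_
      rw [cutBasis_apply, cutRow]
      split_ifs with h
      · simp
      · exact C.sub_mem (hX.row_mem l) (hX.pastRow_mem h)
    have := C.add_mem h2 this
    simp only [smul_sub, Finset.sum_sub_distrib] at this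
    convert this using 1
    abel
  have h4 := hX.cutBasis_repr_eq_zero hl h3
  rw [map_sub, Finsupp.sub_apply, Module.Basis.repr_sum_self, sub_eq_zero] at h4
  exact h4

lemma dependency_eq_zero [NeZero n] (hX : IsCharacteristicPair C X T)
    (hne : ∀ l, (T l).1 ≠ (T l).2) {c : Fin n → F}
    (hc : Matrix.vecMul c X = 0) (hw : ∑ l, c l • pastRow X T 0 l ∈ C) : c = 0 := by
  ext l
  rw [hX.dependency_apply (w := 0) hc (by simpa using hw) (end_mem_halfOpenInterval (hne l))]
  simp

/-- The past at time `0` maps the linear dependencies of the rows onto `F ^ n` modulo the code. -/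
lemma exists_dependency [NeZero n] (hX : IsCharacteristicPair C X T)
    (hne : ∀ l, (T l).1 ≠ (T l).2) (w : Fin n → F) :
    ∃ c : Fin n → F, Matrix.vecMul c X = 0 ∧ ∑ l, c l • pastRow X T 0 l - w ∈ C := by
  let K := LinearMap.ker X.vecMulLinear
  let f : K →ₗ[F] (Fin n → F) ⧸ C :=
    C.mkQ ∘ₗ (Matrix.vecMulLinear (Matrix.of (pastRow X T 0))) ∘ₗ K.subtype
  have hf : ∀ c : K, f c = C.mkQ (∑ l, c.1 l • pastRow X T 0 l) := fun c => by
    simp only [f, LinearMap.comp_apply, Matrix.vecMulLinear_apply, Matrix.vecMul_eq_sum]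
    rfl
  have hinj : Function.Injective f := by
    rw [← LinearMap.ker_eq_bot, LinearMap.ker_eq_bot']
    intro c h
    rw [hf, Submodule.mkQ_apply, Submodule.Quotient.mk_eq_zero] at h
    exact Subtype.ext (hX.dependency_eq_zero hne c.2 h)
  -- Both dimensions are `n - k`, so injectivity suffices.
  have hdim : Module.finrank F K = Module.finrank F ((Fin n → F) ⧸ C) := by
    have h1 := LinearMap.finrank_range_add_finrank_ker X.vecMulLinear
    have h2 := C.finrank_quotient_add_finrank
    rw [range_vecMulLinear, hX.span_rows] at h1
    change _ + Module.finrank F K = _ at h1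
    omega
  obtain ⟨c, hc⟩ := (LinearMap.injective_iff_surjective_of_finrank_eq_finrank hdim).1 hinj
    (C.mkQ w)
  refine ⟨c.1, c.2, ?_⟩
  rw [hf] at hc
  exact (Submodule.Quotient.eq C).1 hc

lemma dual_ncard_eq (hX : IsCharacteristicPair C X T) (hne : ∀ l, (T l).1 ≠ (T l).2)
    (j : Fin n) : {l | j ∈ halfOpenInterval (T l).2 (T l).1}.ncard = Module.finrank F C := by
  have h1 := Set.ncard_add_ncard_compl {l | j ∈ halfOpenInterval (T l).1 (T l).2}
  rw [hX.ncard_eq j, Nat.card_fin] at h1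
  have h2 : {l | j ∈ halfOpenInterval (T l).2 (T l).1} =
      {l | j ∈ halfOpenInterval (T l).1 (T l).2}ᶜ := by
    ext l
    exact mem_halfOpenInterval_swap (hne l) j
  rw [h2]
  have := finrank_code_le C
  omega

/-- A characteristic matrix of the dual code, with reversed spans, whose rows represent the dual
of the matroid of the rows of the given characteristic matrix. -/
theorem exists_dual [NeZero n] (hX : IsCharacteristicPair C X T)
    (hC' : FullSupport (dualCode C)) :
    ∃ X' : Matrix (Fin n) (Fin n) F, (∀ m, X' m ∈ dualCode C) ∧
      (∀ m, IsSpan (X' m) ((T m).2, (T m).1)) ∧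
      ∀ L : Finset (Fin n), Submodule.span F (Set.range fun l : {l // l ∈ L} => X.row l) = C →
        LinearIndependent F fun m : {m // m ∈ Lᶜ} => X'.row m := by
  classical
  have hne := hX.start_ne_end hC'
  choose e he0 he using fun j : Fin n => hX.exists_dependency hne (Pi.single j 1)
  have hcomb : ∀ w : Fin n → F, Matrix.vecMul (∑ j, w j • e j) X = 0 ∧
      ∑ l, (∑ j, w j • e j) l • pastRow X T 0 l - w ∈ C := by
    intro w
    constructor
    · rw [Matrix.sum_vecMul]
      simp [Matrix.smul_vecMul, he0]
    · have h := C.sum_mem (t := Finset.univ) fun j _ => C.smul_mem (w j) (he j)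
      convert h using 1
      simp only [smul_sub, Finset.sum_sub_distrib, Finset.smul_sum, Finset.sum_apply,
        Pi.smul_apply, Finset.sum_smul, smul_eq_mul, mul_smul]
      rw [Finset.sum_comm]
      congr 1
      exact pi_eq_sum_univ' w
  have hspan : ∀ c : Fin n → F, Matrix.vecMul c X = 0 → ∃ w : Fin n → F, c = ∑ j, w j • e j := by
    intro c hc
    refine ⟨∑ l, c l • pastRow X T 0 l, sub_eq_zero.1 ?_⟩
    obtain ⟨h1, h2⟩ := hcomb (∑ l, c l • pastRow X T 0 l)
    apply hX.dependency_eq_zero hne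
    · rw [Matrix.sub_vecMul, hc, h1, sub_zero]
    · convert C.neg_mem h2 using 1
      simp only [Pi.sub_apply, sub_smul, Finset.sum_sub_distrib, neg_sub]
  -- The dependencies `e j` are the columns of the dual matrix.
  refine ⟨Matrix.of fun m j => e j m, ?_, ?_, ?_⟩
  · intro m c hc
    obtain ⟨h1, h2⟩ := hcomb c
    have h0 := hX.dependency_eq_zero hne h1 (by simpa using C.add_mem h2 hc)
    have := congrFun h0 m
    simpa using this
  · intro m
    refine ⟨?_, ?_, ?_⟩
    · have hm := end_mem_halfOpenInterval (hne m)
      show e (T m).2 m ≠ 0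
      rw [hX.dependency_apply (he0 _) (he _) hm]
      have hX0 := (hX.isSpan m).2.1
      -- Cutting `x_m` at `b_m` removes just its last entry; restoring that entry gives a multiple
      -- of `x_m`, which has coordinate zero at `m`. So the unit vector at `b_m` has the nonzero
      -- coordinate `-(X m b_m)⁻¹`.
      have h1 : Pi.single (T m).2 1 + (X m (T m).2)⁻¹ • hX.cutBasis (T m).2 m ∈ C := by
        convert C.smul_mem (X m (T m).2)⁻¹ (hX.row_mem m) using 1
        ext t
        rw [cutBasis_apply, cutRow, if_pos hm]
        simp only [Pi.add_apply, Pi.smul_apply, smul_eq_mul, pastRow]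
        rcases eq_or_ne t (T m).2 with rfl | ht
        · simpa using (inv_mul_cancel₀ hX0).symm
        · rw [Pi.single_eq_of_ne ht, zero_add]
          split_ifs with h
          · rfl
          · refine congrArg _ (IsSpan.eq_zero_of_lt (hX.isSpan m) ?_).symm
            have := t.isLt
            have := (T m).1.isLt
            have := (T m).2.isLt
            simp only [val_sub_eq_ite, Fin.le_def, Ne, Fin.ext_iff] at *
            split_ifs at * <;> omega
      have h2 := hX.cutBasis_repr_eq_zero hm h1
      rw [map_add, Finsupp.add_apply, map_smul, Finsupp.smul_apply, Module.Basis.repr_self,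
        Finsupp.single_eq_same] at h2
      intro h3
      rw [h3] at h2
      simp at h2
      exact hX0 h2
    · show e (T m).1 m ≠ 0
      rw [hX.dependency_apply (he0 _) (he _) (succ_mem_halfOpenInterval
        (mem_closedInterval_iff.2 (by simp)) (hne m)), hX.cutBasis_repr_single (hne m)]
      simp only [Finsupp.single_eq_same]
      exact inv_ne_zero (hX.isSpan m).1
    · intro j hj
      -- Every position is the start `a_s` of some row. If it lies outside `[b_m, a_m]`, then `a_s +
      -- 1` is in the span of row `m`, and at that time the unit vector at `a_s` involves row `s ≠
      -- m` only.
      obtain ⟨s, rfl⟩ := (Finite.injective_iff_surjective.1 hX.start_injective) j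
      have hjb : (T s).1 ≠ (T m).2 := by
        rintro h
        simp only [h] at hj
        exact hj (mem_closedInterval_iff.2 (by simp))
      have hms : s ≠ m := by
        rintro rfl
        exact hj (mem_closedInterval_iff.2 le_rfl)
      have hjm : (T s).1 ∈ halfOpenInterval (T m).1 (T m).2 := by
        by_contra h
        exact hj ((mem_halfOpenInterval_swap (hne m) _).2 h).1
      show e (T s).1 m = 0
      rw [hX.dependency_apply (he0 _) (he _) (succ_mem_halfOpenInterval hjm.1 hjb),
        hX.cutBasis_repr_single (hne s)]
      simp [hms]
  · intro L hL
    rw [Fintype.linearIndependent_iff]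
    intro g hg
    let μ : Fin n → F := fun m => if h : m ∈ Lᶜ then g ⟨m, h⟩ else 0
    have hμ : ∀ j, ∑ m, e j m * μ m = 0 := by
      intro j
      have := congrFun hg j
      rw [Finset.sum_apply] at this
      rw [← Finset.sum_subset (Finset.subset_univ Lᶜ) fun m _ hm => by
        simp only [μ, dif_neg hm, mul_zero], ← Finset.sum_coe_sort]
      refine Eq.trans (Finset.sum_congr rfl fun m _ => ?_) this
      simp only [μ, dif_pos m.2, Pi.smul_apply, smul_eq_mul, mul_comm (g m)]
      rfl
    -- The `e j` span all dependencies, so `μ` is orthogonal to the left kernel of `X` and therefore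
    -- lies in its column space.
    have hμ' : μ ∈ dualCode (dualCode (LinearMap.range X.mulVecLin)) := by
      intro c hc
      obtain ⟨w, rfl⟩ := hspan c (by
        refine dotProduct_eq_zero _ fun v => ?_
        rw [← Matrix.dotProduct_mulVec, dotProduct_comm]
        exact hc _ ⟨v, rfl⟩)
      change (∑ j, w j • e j) ⬝ᵥ μ = 0
      rw [sum_dotProduct]
      refine Finset.sum_eq_zero fun j _ => ?_
      rw [smul_dotProduct]
      simp only [dotProduct, hμ j, smul_zero]
    rw [dualCode_dualCode] at hμ'
    obtain ⟨v, hv⟩ := hμ'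
    -- With `μ = X v`, vanishing on `L` makes `v` orthogonal to rows that span `C`, hence to all
    -- rows, so `μ = 0`.
    have hvC : v ∈ dualCode C := by
      intro x hx
      rw [← hL] at hx
      change x ⬝ᵥ v = 0
      induction hx using Submodule.span_induction with
      | mem x hx =>
        obtain ⟨l, rfl⟩ := hx
        have := congrFun hv l
        have h0 : μ l = 0 := dif_neg (by simp)
        rw [h0] at this
        exact this
      | zero => simp
      | add x y _ _ hx hy => rw [add_dotProduct, hx, hy, add_zero]
      | smul r x _ hx => rw [smul_dotProduct, hx, smul_zero]
    rintro ⟨m, hm⟩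
    have h1 : μ m = 0 := by
      rw [← hv]
      exact hvC _ (hX.row_mem m)
    simpa only [μ, dif_pos hm] using h1

end IsCharacteristicPair

end Core

end TailBiting

namespace TailBiting

namespace Trellis

variable {F : Type u} [Field F] {n : ℕ} [NeZero n]

/-! ### Trimming a trellis with linear label code -/

/-- The subtrellis of the vertices and edges that lie on a cycle. -/
def trim (T : Trellis F n) (S : Submodule F ((∀ i, T.V i) × (Fin n → F))) : Trellis F n where
  V i := S.map (LinearMap.proj i ∘ₗ LinearMap.fst F (∀ i, T.V i) (Fin n → F))
  E i := {e | ∃ p ∈ S, p.1 i = e.1 ∧ p.2 i = e.2.1 ∧ p.1 (i + 1) = e.2.2}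

variable {T : Trellis F n} {S : Submodule F ((∀ i, T.V i) × (Fin n → F))}

lemma mem_labelCode_trim (hS : (S : Set _) = T.labelCode)
    (q : (∀ i, (T.trim S).V i) × (Fin n → F)) :
    q ∈ (T.trim S).labelCode ↔ ((fun i => (q.1 i).1, q.2) : (∀ i, T.V i) × (Fin n → F)) ∈ S := by
  constructor
  · intro h
    rw [← SetLike.mem_coe, hS]
    intro i
    obtain ⟨p, hp, h1, h2, h3⟩ := h i
    rw [← SetLike.mem_coe, hS] at hp
    have := hp i
    rw [h1, h2, h3] at this
    exact this
  · intro h i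
    exact ⟨_, h, rfl, rfl, rfl⟩

/-- A cycle of the trellis, as a cycle of the trimmed trellis. -/
def liftTrim (p : (∀ i, T.V i) × (Fin n → F)) (hp : p ∈ S) :
    (∀ i, (T.trim S).V i) × (Fin n → F) :=
  (fun i => ⟨p.1 i, Submodule.mem_map.2 ⟨p, hp, rfl⟩⟩, p.2)

lemma liftTrim_mem (hS : (S : Set _) = T.labelCode) (p : (∀ i, T.V i) × (Fin n → F))
    (hp : p ∈ S) : liftTrim p hp ∈ (T.trim S).labelCode :=
  (mem_labelCode_trim hS _).2 hp

lemma isLinear_trim (hS : (S : Set _) = T.labelCode) : (T.trim S).IsLinear := by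
  refine ⟨⟨?_, ?_⟩, S.comap (LinearMap.prodMap
    (LinearMap.pi fun i => (Submodule.subtype _) ∘ₗ LinearMap.proj i) LinearMap.id), ?_⟩
  · rintro i ⟨_, p, hp, rfl⟩
    exact ⟨liftTrim p hp, liftTrim_mem hS p hp, rfl⟩
  · rintro i ⟨v, c, w⟩ ⟨p, hp, h1, h2, h3⟩
    refine ⟨liftTrim p hp, liftTrim_mem hS p hp, ?_⟩
    exact Prod.ext (Subtype.ext h1) (Prod.ext h2 (Subtype.ext h3))
  · ext q
    rw [mem_labelCode_trim hS]
    rfl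

lemma edgeLabelCode_trim (hS : (S : Set _) = T.labelCode) :
    (T.trim S).edgeLabelCode = T.edgeLabelCode := by
  ext c
  constructor
  · rintro ⟨v, hv⟩
    refine ⟨fun i => (v i).1, ?_⟩
    rw [← hS]
    exact (mem_labelCode_trim hS _).1 hv
  · rintro ⟨v, hv⟩
    rw [← hS] at hv
    exact ⟨_, liftTrim_mem hS (v, c) hv⟩

/-! ### The local dual of a trellis -/

/-- The local dual: dual vertex spaces, and the (signed) annihilators of the edge spaces. -/
def localDual (T : Trellis F n) : Trellis F n where
  V i := Module.Dual F (T.V i)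
  E i := {e | ∀ v c w, (v, c, w) ∈ T.E i → e.1 v + e.2.1 * c = e.2.2 w}

/-- The label code of the local dual, as a subspace. -/
def dualLabelCode (T : Trellis F n) :
    Submodule F ((∀ i, T.localDual.V i) × (Fin n → F)) where
  carrier := T.localDual.labelCode
  zero_mem' := fun i v c w _ => by
    show (0 : Module.Dual F (T.V i)) v + 0 * c = (0 : Module.Dual F (T.V (i + 1))) w
    simp
  add_mem' := by
    rintro p q hp hq i v c w h
    have h1 := hp i v c w h
    have h2 := hq i v c w h
    change (show Module.Dual F (T.V i) from p.1 i) v + _ =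
      (show Module.Dual F (T.V (i + 1)) from p.1 (i + 1)) w at h1
    change (show Module.Dual F (T.V i) from q.1 i) v + _ =
      (show Module.Dual F (T.V (i + 1)) from q.1 (i + 1)) w at h2
    change (show Module.Dual F (T.V i) from p.1 i) v +
      (show Module.Dual F (T.V i) from q.1 i) v + (p.2 i + q.2 i) * c =
      (show Module.Dual F (T.V (i + 1)) from p.1 (i + 1)) w +
      (show Module.Dual F (T.V (i + 1)) from q.1 (i + 1)) w
    rw [← h1, ← h2]
    ring
  smul_mem' := by
    rintro r p hp i v c w h
    have h1 := hp i v c w h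
    change (show Module.Dual F (T.V i) from p.1 i) v + _ =
      (show Module.Dual F (T.V (i + 1)) from p.1 (i + 1)) w at h1
    change r * (show Module.Dual F (T.V i) from p.1 i) v + (r * p.2 i) * c =
      r * (show Module.Dual F (T.V (i + 1)) from p.1 (i + 1)) w
    rw [← h1]
    ring

/-- The edge space at time `i` of a trellis with linear label code. -/
def edgeSpace (T : Trellis F n) (S : Submodule F ((∀ i, T.V i) × (Fin n → F))) (i : Fin n) :
    Submodule F (T.V i × F × T.V (i + 1)) :=
  S.map (LinearMap.prod (LinearMap.proj i ∘ₗ LinearMap.fst F (∀ i, T.V i) (Fin n → F))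
    (LinearMap.prod (LinearMap.proj i ∘ₗ LinearMap.snd F (∀ i, T.V i) (Fin n → F))
      (LinearMap.proj (i + 1) ∘ₗ LinearMap.fst F (∀ i, T.V i) (Fin n → F))))

lemma mem_edgeSpace_iff (hT : T.IsReduced) (hS : (S : Set _) = T.labelCode) {i : Fin n}
    {e : T.V i × F × T.V (i + 1)} : e ∈ T.edgeSpace S i ↔ e ∈ T.E i := by
  constructor
  · rintro ⟨p, hp, rfl⟩
    rw [hS] at hp
    exact hp i
  · intro he
    obtain ⟨p, hp, hpe⟩ := hT.2 i e he
    rw [← hS] at hp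
    exact ⟨p, hp, hpe⟩

/-- A linear functional that vanishes on the kernel of `f` factors through `f`. -/
lemma exists_dual_comp_eq {V W : Type*} [AddCommGroup V] [Module F V] [AddCommGroup W]
    [Module F W] (f : V →ₗ[F] W) (g : Module.Dual F V) (h : LinearMap.ker f ≤ LinearMap.ker g) :
    ∃ ψ : Module.Dual F W, ∀ v, ψ (f v) = g v := by
  have : g ∈ LinearMap.range f.dualMap := by
    rw [LinearMap.range_dualMap_eq_dualAnnihilator_ker, Submodule.mem_dualAnnihilator]
    exact fun v hv => h hv
  obtain ⟨ψ, hψ⟩ := this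
  exact ⟨ψ, fun v => LinearMap.congr_fun hψ v⟩

/-- Normal graph duality: the local dual of a linear trellis represents the dual code. -/
theorem represents_localDual {C : Submodule F (Fin n → F)} (hT : T.IsLinear)
    (hTC : T.Represents C) : T.localDual.Represents (dualCode C) := by
  classical
  obtain ⟨hred, S, hS⟩ := hT
  ext d
  constructor
  · rintro ⟨φ, hφ⟩ c hc
    obtain ⟨v, hv⟩ : c ∈ T.edgeLabelCode := hTC ▸ hc
    let ψ : ∀ i, Module.Dual F (T.V i) := φ
    have h : ∀ i, ψ i (v i) + d i * c i = ψ (i + 1) (v (i + 1)) := fun i => hφ i _ _ _ (hv i)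
    -- Summed around the cycle, the vertex terms cancel and only the pairing of the labels remains.
    have h2 : ∑ i, ψ (i + 1) (v (i + 1)) = ∑ i, ψ i (v i) :=
      Equiv.sum_comp (Equiv.addRight (1 : Fin n)) fun i => ψ i (v i)
    rw [← Finset.sum_congr rfl fun i _ => h i, Finset.sum_add_distrib] at h2
    simpa [mul_comm] using h2
  · intro hd
    -- `f` measures how far a choice of one edge per time is from closing up, so its kernel consists
    -- of the cycles. There the pairing `g` with `d` vanishes, so `g` factors through `f`; the
    -- components of the factor are the dual vertices.
    let f : (∀ i, T.edgeSpace S i) →ₗ[F] (∀ i, T.V (i + 1)) := LinearMap.pi fun i =>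
      (LinearMap.snd F _ _ ∘ₗ LinearMap.snd F _ _ ∘ₗ Submodule.subtype _ ∘ₗ LinearMap.proj i) -
      (LinearMap.fst F _ _ ∘ₗ Submodule.subtype _ ∘ₗ LinearMap.proj (i + 1))
    let g : Module.Dual F (∀ i, T.edgeSpace S i) := ∑ i, d i •
      (LinearMap.fst F _ _ ∘ₗ LinearMap.snd F _ _ ∘ₗ Submodule.subtype _ ∘ₗ LinearMap.proj i)
    have hf : ∀ e i, f e i = (e i).1.2.2 - (e (i + 1)).1.1 := fun e i => rfl
    have hg : ∀ e, g e = ∑ i, d i * (e i).1.2.1 := fun e => by simp [g]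
    obtain ⟨ψ, hψ⟩ := exists_dual_comp_eq f g (by
      intro e he
      rw [LinearMap.mem_ker] at he ⊢
      have hcyc : (fun i => (e i).1.2.1) ∈ T.edgeLabelCode := by
        refine ⟨fun i => (e i).1.1, fun i => ?_⟩
        have h0 : (e i).1.2.2 = (e (i + 1)).1.1 := sub_eq_zero.1 (congrFun he i)
        show ((e i).1.1, (e i).1.2.1, (e (i + 1)).1.1) ∈ T.E i
        rw [← h0]
        exact (mem_edgeSpace_iff hred hS).1 (e i).2
      rw [hTC] at hcyc
      rw [hg, ← hd _ hcyc]
      exact Finset.sum_congr rfl fun i _ => mul_comm _ _)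
    let φ : ∀ j, Module.Dual F (T.V j) := fun j =>
      ψ ∘ₗ (LinearMap.pi fun i => LinearMap.proj (i + 1)) ∘ₗ LinearMap.single F T.V j
    refine ⟨φ, fun i v c w h => ?_⟩
    show φ i v + d i * c = φ (i + 1) w
    have he : (v, c, w) ∈ T.edgeSpace S i := (mem_edgeSpace_iff hred hS).2 h
    let e : ∀ i, T.edgeSpace S i := Pi.single i ⟨(v, c, w), he⟩
    have hge : g e = d i * c := by
      rw [hg, Finset.sum_eq_single i]
      · simp [e]
      · intro j _ hj
        simp [e, Pi.single_eq_of_ne hj]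
      · simp
    have hfe : f e = (fun j => (Pi.single (i + 1) w : ∀ j, T.V j) (j + 1)) -
        fun j => (Pi.single i v : ∀ j, T.V j) (j + 1) := by
      ext j
      rw [hf, Pi.sub_apply]
      congr 1
      · rcases eq_or_ne j i with rfl | hj
        · simp [e]
        · rw [Pi.single_eq_of_ne (fun h => hj (add_right_cancel h))]
          simp [e, Pi.single_eq_of_ne hj]
      · rcases eq_or_ne (j + 1) i with hj | hj
        · subst hj
          simp [e]
        · rw [Pi.single_eq_of_ne hj]
          simp [e, Pi.single_eq_of_ne hj]
    have := hψ e
    rw [hge, hfe, map_sub] at this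
    rw [← this]
    exact add_sub_cancel _ _

/-- Sizes do not grow under trimming the local dual. -/
lemma mk_trim_localDual_le [Finite F] (S : Submodule F ((∀ i, T.localDual.V i) × (Fin n → F)))
    (i : Fin n) (h : Finite (T.V i)) :
    Cardinal.mk ((T.localDual.trim S).V i) ≤ Cardinal.mk (T.V i) := by
  have : FiniteDimensional F (T.V i) := Module.Finite.of_finite
  calc Cardinal.mk ((T.localDual.trim S).V i) ≤ Cardinal.mk (Module.Dual F (T.V i)) :=
        Cardinal.mk_subtype_le _
    _ = Cardinal.mk (T.V i) :=
      (LinearEquiv.ofFinrankEq _ _ Subspace.dual_finrank_eq).toEquiv.cardinal_eq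

/-- A linear trellis of the dual code is minimal if its vertex spaces have the same sizes as those
of a minimal trellis of the code. -/
theorem IsMinimal.dual [Finite F] {C : Submodule F (Fin n → F)} {T T' : Trellis F n}
    (hT : T.IsMinimal C) (hfin : ∀ i, Finite (T.V i)) (hT' : T'.IsLinear)
    (hC' : T'.Represents (dualCode C))
    (hcard : ∀ i, Cardinal.mk (T'.V i) = Cardinal.mk (T.V i)) : T'.IsMinimal (dualCode C) := by
  refine ⟨hT', hC', ?_⟩
  rintro ⟨U, hU, hUC, hle, j, hj⟩
  have hUfin : ∀ i, Finite (U.V i) := fun i => by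
    rw [← Cardinal.lt_aleph0_iff_finite]
    exact ((hle i).trans (hcard i).le).trans_lt (Cardinal.lt_aleph0_iff_finite.2 (hfin i))
  have hrep := represents_localDual hU hUC
  rw [dualCode_dualCode] at hrep
  -- The local dual need not be reduced; trimming makes it linear without enlarging vertex spaces.
  refine hT.2.2 ⟨U.localDual.trim U.dualLabelCode, isLinear_trim rfl, ?_, fun i => ?_, j, ?_⟩
  · exact (edgeLabelCode_trim rfl).trans hrep
  · exact ((mk_trim_localDual_le _ i (hUfin i)).trans (hle i)).trans (hcard i).le
  · exact (mk_trim_localDual_le _ j (hUfin j)).trans_lt (hj.trans_eq (hcard j))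

/-! ### Products of elementary trellises -/

/-- The cycles of an elementary trellis are the multiples of the generator. -/
lemma exists_eq_of_mem_labelCode_elementary {c : Fin n → F} {s : Fin n × Fin n}
    (hc : IsSpan c s) {p : (∀ i, (elementary c s).V i) × (Fin n → F)}
    (hp : p ∈ (elementary c s).labelCode) :
    ∃ α : F, ∀ i, (p.1 i).1 = α * spanIndicator F s i ∧ p.2 i = α * c i := by
  choose α hα using hp
  have h1 : ∀ i, (p.1 i).1 = α i * spanIndicator F s i := fun i =>
    (congrArg (fun e => e.1.1) (hα i)).symm
  have h2 : ∀ i, p.2 i = α i * c i := fun i => (congrArg (fun e => e.2.1) (hα i)).symm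
  have h3 : ∀ i, (p.1 (i + 1)).1 = α i * spanIndicator F s (i + 1) := fun i =>
    (congrArg (fun e => e.2.2.1) (hα i)).symm
  have hI : ∀ i ∈ halfOpenInterval s.1 s.2, spanIndicator F s i = 1 := fun i hi => by
    simp [spanIndicator, hi]
  -- Consecutive edges share a vertex, which determines the coefficient inside `(a, b]`; so the
  -- coefficient is constant on `[a, b]`, by induction on the distance from `a`. Elsewhere vertex
  -- and label are zero.
  have hconst : ∀ d : ℕ, ∀ i : Fin n, (i - s.1).val = d → i ∈ closedInterval s.1 s.2 →
      α i = α s.1 := by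
    intro d
    induction d with
    | zero =>
      intro i hd _
      rw [sub_eq_zero.1 (Fin.ext hd : i - s.1 = 0)]
    | succ d ih =>
      intro i hd hi
      have hne : i ≠ s.1 := by
        rintro rfl
        simp at hd
      have hmem : i ∈ halfOpenInterval s.1 s.2 := ⟨hi, hne⟩
      have hi' : i - 1 + 1 = i := sub_add_cancel i 1
      have h13 := h3 (i - 1)
      rw [hi', h1 i, hI i hmem, mul_one, mul_one] at h13
      rw [h13]
      have hcl : i - 1 ∈ closedInterval s.1 s.2 := mem_closedInterval_of_succ (hi'.symm ▸ hmem)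
      refine ih _ ?_ hcl
      have h4 := val_add_one_eq_ite (i - 1 - s.1)
      rw [show i - 1 - s.1 + 1 = i - s.1 by abel, hd] at h4
      split_ifs at h4
      omega
  refine ⟨α s.1, fun i => ?_⟩
  by_cases hi : i ∈ closedInterval s.1 s.2
  · rw [← hconst _ i rfl hi]
    exact ⟨h1 i, h2 i⟩
  · have hI0 : spanIndicator F s i = 0 := by
      have : i ∉ halfOpenInterval s.1 s.2 := fun h => hi h.1
      simp [spanIndicator, this]
    rw [h1, h2, hI0, hc.2.2 i hi]
    simp

variable {ι : Type} [Fintype ι] {c : ι → Fin n → F} {s : ι → Fin n × Fin n}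

/-- The cycle of a product of elementary trellises with the given coefficients. -/
noncomputable def productCycle (c : ι → Fin n → F) (s : ι → Fin n × Fin n) :
    (ι → F) →ₗ[F] (∀ i, (product fun l => elementary (c l) (s l)).V i) × (Fin n → F) where
  toFun α := (fun i l => ⟨α l * spanIndicator F (s l) i,
    Submodule.mem_span_singleton.2 ⟨α l, rfl⟩⟩, ∑ l, α l • c l)
  map_add' α β := by
    refine Prod.ext ?_ ?_
    · funext i l
      exact Subtype.ext (add_mul _ _ _)
    · simp [add_smul, Finset.sum_add_distrib]
  map_smul' r α := by
    refine Prod.ext ?_ ?_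
    · funext i l
      exact Subtype.ext (mul_assoc _ _ _)
    · simp [mul_smul, Finset.smul_sum]

lemma productCycle_mem (α : ι → F) :
    productCycle c s α ∈ (product fun l => elementary (c l) (s l)).labelCode := by
  intro i
  refine ⟨fun l => α l * c l i, fun l => ⟨α l, rfl⟩, ?_⟩
  simp [productCycle]

lemma range_productCycle (hc : ∀ l, IsSpan (c l) (s l)) :
    (LinearMap.range (productCycle c s) : Set _) =
      (product fun l => elementary (c l) (s l)).labelCode := by
  ext p
  constructor
  · rintro ⟨α, rfl⟩
    exact productCycle_mem α
  · intro hp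
    choose a ha hsum using hp
    choose α hα using fun l => exists_eq_of_mem_labelCode_elementary (hc l)
      (p := (fun i => p.1 i l, fun i => a i l)) (fun i => ha i l)
    refine ⟨α, Prod.ext ?_ ?_⟩
    · funext i l
      exact Subtype.ext (hα l i).1.symm
    · funext i
      refine Eq.trans ?_ (hsum i).symm
      simp only [productCycle, LinearMap.coe_mk, AddHom.coe_mk, Finset.sum_apply]
      exact Finset.sum_congr rfl fun l _ => (hα l i).2.symm

lemma isLinear_product_elementary (hc : ∀ l, IsSpan (c l) (s l)) :
    (product fun l => elementary (c l) (s l)).IsLinear := by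
  refine ⟨⟨?_, ?_⟩, _, range_productCycle hc⟩
  · intro i v
    choose α hα using fun l => Submodule.mem_span_singleton.1 (v l).2
    refine ⟨_, productCycle_mem α, ?_⟩
    funext l
    exact Subtype.ext (hα l)
  · rintro i ⟨v, b, w⟩ ⟨a, ha, hb⟩
    choose α hα using ha
    refine ⟨_, productCycle_mem α, Prod.ext ?_ (Prod.ext ?_ ?_)⟩
    · funext l
      exact congrArg (fun e => e.1) (hα l)
    · refine Eq.trans ?_ hb.symm
      simp only [productCycle, LinearMap.coe_mk, AddHom.coe_mk, Finset.sum_apply]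
      exact Finset.sum_congr rfl fun l _ => congrArg (fun e => e.2.1) (hα l)
    · funext l
      exact congrArg (fun e => e.2.2) (hα l)

lemma represents_product_elementary (hc : ∀ l, IsSpan (c l) (s l)) :
    (product fun l => elementary (c l) (s l)).Represents (Submodule.span F (Set.range c)) := by
  ext x
  rw [SetLike.mem_coe, Submodule.mem_span_range_iff_exists_fun]
  constructor
  · rintro ⟨v, hv⟩
    rw [← range_productCycle hc] at hv
    obtain ⟨α, hα⟩ := hv
    exact ⟨α, congrArg Prod.snd hα⟩
  · rintro ⟨α, rfl⟩
    exact ⟨_, productCycle_mem α⟩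

open Classical in
lemma finrank_product_elementary (c : ι → Fin n → F) (s : ι → Fin n × Fin n) (i : Fin n) :
    Module.finrank F ((product fun l => elementary (c l) (s l)).V i) =
      (Finset.univ.filter fun l => i ∈ halfOpenInterval (s l).1 (s l).2).card := by
  change Module.finrank F (∀ l, Submodule.span F {spanIndicator F (s l) i}) = _
  rw [Module.finrank_pi_fintype, Finset.card_filter]
  refine Finset.sum_congr rfl fun l _ => ?_
  split_ifs with h
  · rw [finrank_span_singleton]
    simp [spanIndicator, h]
  · have : spanIndicator F (s l) i = 0 := by simp [spanIndicator, h]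
    rw [this, Submodule.span_zero_singleton, finrank_bot]

instance [Finite F] (i : Fin n) : Finite ((product fun l => elementary (c l) (s l)).V i) := by
  change Finite (∀ l, Submodule.span F {spanIndicator F (s l) i})
  infer_instance

end Trellis

end TailBiting

/-! ### The complementary selection and the main theorem. -/

namespace TailBiting

variable {F : Type u} [Field F] {n : ℕ}

lemma complementaryRows_swap {T : Fin n → Fin n × Fin n}
    (hT : Function.Injective fun l => (T l).1) (L : Finset (Fin n)) :
    complementaryRows T L (fun m => ((T m).2, (T m).1)) = Lᶜ := by
  ext m
  simp only [complementaryRows, Finset.mem_filter, Finset.mem_univ, true_and, Finset.mem_compl]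
  constructor
  · exact fun h hm => h m hm rfl
  · intro hm l hl h
    have : m = l := hT (congrArg Prod.snd h)
    exact hm (this ▸ hl)

lemma span_eq_of_linearIndependent {D : Submodule F (Fin n → F)} {M : Finset (Fin n)}
    {Y : Fin n → Fin n → F} (hY : ∀ m, Y m ∈ D) (hcard : M.card = Module.finrank F D)
    (hli : LinearIndependent F fun m : {m // m ∈ M} => Y m) :
    Submodule.span F (Set.range fun m : {m // m ∈ M} => Y m) = D := by
  apply Submodule.eq_of_le_of_finrank_eq
  · rw [Submodule.span_le]
    rintro _ ⟨m, rfl⟩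
    exact hY m
  · rw [finrank_span_eq_card hli, Fintype.card_coe, hcard]

open Trellis in
/-- A selection of rows and the complementary selection with reversed spans give trellises with
vertex spaces of the same dimensions. -/
lemma finrank_selectionTrellis_compl [NeZero n] {C : Submodule F (Fin n → F)}
    {X : Matrix (Fin n) (Fin n) F} {T : Fin n → Fin n × Fin n}
    (hX : IsCharacteristicPair C X T) (hne : ∀ l, (T l).1 ≠ (T l).2) {L : Finset (Fin n)}
    (hcard : L.card = Module.finrank F C) (X' : Matrix (Fin n) (Fin n) F) (i : Fin n) :
    Module.finrank F ((selectionTrellis X' (fun m => ((T m).2, (T m).1)) Lᶜ).V i) =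
      Module.finrank F ((selectionTrellis X T L).V i) := by
  classical
  rw [selectionTrellis, selectionTrellis, finrank_product_elementary, finrank_product_elementary]
  have hcount : ∀ (M : Finset (Fin n)) (p : Fin n → Prop),
      (Finset.univ.filter fun l : {l // l ∈ M} => p l).card = (M.filter p).card := by
    intro M p
    rw [Finset.card_filter, Finset.card_filter, ← Finset.sum_coe_sort M]
  rw [hcount Lᶜ fun l => i ∈ halfOpenInterval (T l).2 (T l).1,
    hcount L fun l => i ∈ halfOpenInterval (T l).1 (T l).2]
  -- In total `k = |L|` reversed spans contain `i`. Those from `L` number `k` minus the original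
  -- spans from `L` containing `i`, so the remaining ones, from outside `L`, are as many as those
  -- original spans.
  have h1 := hX.dual_ncard_eq hne i
  rw [← hcard, Set.ncard_eq_toFinset_card', Set.toFinset_ofPred] at h1
  have h2 : (Finset.univ.filter fun l => i ∈ halfOpenInterval (T l).2 (T l).1).card =
      (L.filter fun l => i ∈ halfOpenInterval (T l).2 (T l).1).card +
      (Lᶜ.filter fun l => i ∈ halfOpenInterval (T l).2 (T l).1).card := by
    simp only [Finset.card_filter]
    exact (Finset.sum_add_sum_compl L _).symm
  have h3 := Finset.card_filter_add_card_filter_not (s := L)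
    fun l => i ∈ halfOpenInterval (T l).1 (T l).2
  simp only [← mem_halfOpenInterval_swap (hne _)] at h3
  omega

end TailBiting

open TailBiting in
theorem mainTheorem2 {F : Type u} [Field F] [Finite F] {n : ℕ} [NeZero n]
    (C : Submodule F (Fin n → F)) (hC : FullSupport C) (hC' : FullSupport (dualCode C))
    (X : Matrix (Fin n) (Fin n) F) (T : Fin n → Fin n × Fin n)
    (hX : IsCharacteristicPair C X T) (L : Finset (Fin n))
    (hcard : L.card = Module.finrank F C)
    (hli : LinearIndependent F (fun l : {l // l ∈ L} => X.row l))
    (hmin : (selectionTrellis X T L).IsMinimal C) :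
    ∃ (X' : Matrix (Fin n) (Fin n) F) (T' : Fin n → Fin n × Fin n),
      IsCharacteristicPair (dualCode C) X' T' ∧
      (complementaryRows T L T').card = n - Module.finrank F C ∧
      LinearIndependent F (fun j : {j // j ∈ complementaryRows T L T'} => X'.row j) ∧
      (selectionTrellis X' T' (complementaryRows T L T')).IsMinimal (dualCode C) := by
  have hne := hX.start_ne_end hC'
  obtain ⟨X', hmem, hspan, hind⟩ := hX.exists_dual hC'
  have hli' := hind L (span_eq_of_linearIndependent hX.row_mem hcard hli)
  have hcard' : Lᶜ.card = n - Module.finrank F C := by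
    rw [Finset.card_compl, Fintype.card_fin, hcard]
  have hspan' := span_eq_of_linearIndependent hmem (hcard'.trans (finrank_dualCode C).symm) hli'
  -- Reversal exchanges the roles of the distinct starts and the distinct ends. The rows of `X'`
  -- outside `L` already span the dual code.
  refine ⟨X', fun m => ((T m).2, (T m).1), ⟨?_, hspan, hX.end_injective, hX.start_injective, ?_⟩, ?_⟩
  · refine le_antisymm (Submodule.span_le.2 ?_) ?_
    · rintro _ ⟨m, rfl⟩
      exact hmem m
    · rw [← hspan']
      refine Submodule.span_mono ?_
      rintro _ ⟨m, rfl⟩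
      exact ⟨m, rfl⟩
  · intro j
    rw [hX.dual_ncard_eq hne j, finrank_dualCode]
    have := finrank_code_le C
    omega
  · rw [complementaryRows_swap hX.start_injective]
    refine ⟨hcard', hli', ?_⟩
    have hfin : ∀ (Y : Matrix (Fin n) (Fin n) F) (T : Fin n → Fin n × Fin n)
        (M : Finset (Fin n)) (i : Fin n), Finite ((selectionTrellis Y T M).V i) := fun Y T M i => by
      unfold selectionTrellis
      infer_instance
    refine hmin.dual (hfin X T L) (Trellis.isLinear_product_elementary fun m => hspan m) ?_ fun i => ?_
    · have := Trellis.represents_product_elementary (c := fun m : {m // m ∈ Lᶜ} => X'.row m)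
        (s := fun m => ((T m).2, (T m).1)) fun m => hspan m
      exact this.trans (congrArg _ hspan')
    · have := hfin X T L i
      have := hfin X' (fun m => ((T m).2, (T m).1)) Lᶜ i
      have h1 : FiniteDimensional F ((selectionTrellis X T L).V i) := Module.Finite.of_finite
      have h2 : FiniteDimensional F
        ((selectionTrellis X' (fun m => ((T m).2, (T m).1)) Lᶜ).V i) := Module.Finite.of_finite
      exact (LinearEquiv.ofFinrankEq _ _
        (finrank_selectionTrellis_compl hX hne hcard X' i)).toEquiv.cardinal_eq
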